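/- Define $A_0(j)=2j$ for $j\ge 0$, $A_k(0)=1$ for $k\ge 1$, and $A_k(j)=A_{k-1}(A_k(j-1))$ for $k,j\ge 1$, and let $\alpha(m,n)=\min\{s\ge 1 : A_s(4\lceil m/n\rceil)\ge \log_2 n\}$ be the two-parameter inverse Ackermann function. For a finite set $X\subset\mathbb R^d$ and $t\ge 1$, a (possibly Steiner) Euclidean $t$-spanner for $X$ is a graph $H=(V,E)$ with $X\subseteq V\subseteq\mathbb R^d$, each edge $(x,y)$ having weight $\|x-y\|$, such that every two distinct points $p,q\in X$ are joined in $H$ by a $t$-spanner path, i.e. a path of total weight at most $t\|p-q\|$. Its diameter is the maximum, over all pairs of distinct points $p,q\in X$, of the minimum number of edges of a $t$-spanner path between $p$ and $q$ in $H$. There is an absolute constant $c>0$ such that for every $\epsilon>0$ and every integer $n\ge 2$ there is a set $X$ of $n$ points on the $x$-axis with the following property: for every $d\ge 1$ (regarding the $x$-axis as the first coordinate axis of $\mathbb R^d$) and every integer $m \ge 0$, every (possibly Steiner) Euclidean $(1+\epsilon)$-spanner for $X$ in $\mathbb R^d$ with at most $m$ edges has diameter at least $c\cdot\alpha(m,n)$.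 (No such spanner exists for $m=0$; for $m\ge1$ the minimum defining $\alpha(m,n)$ exists.) -/

import Mathlib

open scoped ENNReal

/-- The rapidly growing functions `A_k(n)`: `A_0(n) = 2n`, `A_k(0) = 1` for `k ≥ 1`, and
`A_k(n) = A_{k-1}(A_k(n-1))` for `k, n ≥ 1`.  Also written `A(k, n)`. -/
def ackA : ℕ → ℕ → ℕ
  | 0, n => 2 * n
  | _ + 1, 0 => 1
  | k + 1, n + 1 => ackA k (ackA (k + 1) n)

/-- The two-parameter inverse Ackermann function
`α(m, n) = min {s ≥ 1 : A(s, 4⌈m/n⌉) ≥ log₂ n}`.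
(The set is nonempty whenever `m, n ≥ 1`.) -/
noncomputable def invAck (m n : ℕ) : ℕ :=
  sInf {s : ℕ | 1 ≤ s ∧ Real.logb 2 (n : ℝ) ≤ (ackA s (4 * ⌈(m : ℝ) / (n : ℝ)⌉₊) : ℝ)}

section Geometric

variable {P : Type*} [MetricSpace P] {V : Set P}

/-- The weight of a walk in a geometric graph on a set `V` of points: the sum of the
distances between the endpoints of its edges. -/
noncomputable def walkWeight {H : SimpleGraph V} {u v : V} (w : H.Walk u v) : ℝ :=
  (w.darts.map fun e => dist (e.fst : P) (e.snd : P)).sum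

/-- A `t`-spanner path between `u` and `v`: a path whose weight is at most `t` times the distance
between `u` and `v`. -/
def IsSpannerPath {H : SimpleGraph V} (t : ℝ) {u v : V} (w : H.Walk u v) : Prop :=
  w.IsPath ∧ walkWeight w ≤ t * dist (u : P) (v : P)

/-- The geometric graph `H` with vertex set `V` is a (possibly Steiner) `t`-spanner for `X`:
`X ⊆ V`, and every two distinct points of `X` are joined by a `t`-spanner path in `H`.
The points of `V \ X` are the Steiner points; `V = X` gives an ordinary spanner. -/
structure IsSteinerSpanner (t : ℝ) (X : Set P) (H : SimpleGraph V) : Prop where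
  subset : X ⊆ V
  exists_path : ∀ p q : V, (p : P) ∈ X → (q : P) ∈ X → p ≠ q →
    ∃ w : H.Walk p q, IsSpannerPath t w

/-- The diameter of a `t`-spanner `H` for `X`: the maximum, over pairs of distinct points of `X`,
of the minimum number of edges of a `t`-spanner path between them. -/
noncomputable def spannerDiameter (t : ℝ) (X : Set P) (H : SimpleGraph V) : ℕ∞ :=
  ⨆ (p : V) (q : V) (_ : (p : P) ∈ X) (_ : (q : P) ∈ X) (_ : p ≠ q),
    ⨅ (w : H.Walk p q) (_ : IsSpannerPath t w), (w.length : ℕ∞)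

end Geometric

/-- A set of reals, placed on the `x`-axis (the first coordinate axis) of `ℝ^d`. -/
def onXAxis (d : ℕ) [NeZero d] (X : Set ℝ) : Set (EuclideanSpace ℝ (Fin d)) :=
  (fun x : ℝ => EuclideanSpace.single (0 : Fin d) x) '' X

/-! ### The functions `ackA` -/

/-! Take the points `spread R i`, `i < n`, with `R ≥ 2t + 2` and `t = 1 + ε`: each dyadic block of
indices is a cluster, separated from all other indices by more than `2t` times its diameter. A
`t`-spanner path stays within `t‖p - q‖` of `p`. Moving every vertex, Steiner or not, to its nearest
input point therefore keeps the path in every dyadic block containing `p` and `q` and adds no edges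
(`exists_isHopSpanner`). Geometry is gone: what remains is a hop spanner on a binary hierarchy.

Such a spanner with `2i` hops needs many edges (`two_mul_card_le_of_isHopSpanner`). Cut at blocks of
length `2 ^ b`. Edges inside blocks are counted by induction on the density `j`. If few edges cross,
most vertices touch no crossing edge, so their walks begin and end with a hop inside a block;
contracting blocks leaves `2i - 2` hops, and induction on `i` applies. The depth consumed,
`hopDepth`, is at most an Ackermann function whose level is linear in `i`, so few edges force `k ≥
α(m, n) - 4`. -/

theorem two_mul_le_ackA (k n : ℕ) : 2 * n ≤ ackA k n := by
  induction k generalizing n with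
  | zero => simp [ackA]
  | succ k ih =>
    induction n with
    | zero => simp
    | succ n ihn =>
      rw [ackA]
      rcases Nat.eq_zero_or_pos n with rfl | hn
      · have := ih 1
        simpa [ackA] using this
      · have := ih (ackA (k + 1) n)
        omega

theorem ackA_strictMono (k : ℕ) : StrictMono (ackA k) := by
  refine strictMono_nat_of_lt_succ fun n => ?_
  cases k with
  | zero => simp [ackA]
  | succ k =>
    rw [ackA]
    have h := two_mul_le_ackA k (ackA (k + 1) n)
    have h' := two_mul_le_ackA (k + 1) n
    rcases Nat.eq_zero_or_pos n with rfl | hn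
    · simp only [ackA] at h ⊢
      omega
    · omega

theorem ackA_pos_of_succ (k n : ℕ) : 0 < ackA (k + 1) n := by
  have h : ackA (k + 1) 0 = 1 := by simp [ackA]
  have := (ackA_strictMono (k + 1)).monotone (Nat.zero_le n)
  omega

theorem two_mul_ackA_le_ackA_succ (k n : ℕ) : 2 * ackA (k + 1) n ≤ ackA (k + 1) (n + 1) := by
  rw [ackA]
  exact two_mul_le_ackA k _

theorem ackA_le_succ_left (k n : ℕ) : ackA k n ≤ ackA (k + 1) n := by
  cases n with
  | zero => cases k <;> simp [ackA]
  | succ n =>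
    rw [ackA]
    refine (ackA_strictMono k).monotone ?_
    induction n with
    | zero => simp [ackA]
    | succ n ih =>
      have := two_mul_ackA_le_ackA_succ k n
      omega

theorem ackA_mono_left {k l : ℕ} (h : k ≤ l) (n : ℕ) : ackA k n ≤ ackA l n :=
  monotone_nat_of_le_succ (f := fun k => ackA k n) (fun k => ackA_le_succ_left k n) h

theorem ackA_add_le (k n y : ℕ) : ackA k n + y ≤ ackA k (n + y) := by
  induction y with
  | zero => simp
  | succ y ih =>
    have : ackA k (n + y) < ackA k (n + (y + 1)) := ackA_strictMono k (by omega)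
    omega

theorem ackA_one (n : ℕ) : ackA 1 n = 2 ^ n := by
  induction n with
  | zero => simp [ackA]
  | succ n ih => rw [ackA, ih, ackA, pow_succ, mul_comm]

theorem ackA_two_succ (n : ℕ) : ackA 2 (n + 1) = 2 ^ ackA 2 n := by
  rw [ackA, ackA_one]

theorem ackA_two_three : ackA 2 3 = 16 := by
  simp [ackA]

theorem ackA_two_four : ackA 2 4 = 65536 := by
  rw [ackA_two_succ, ackA_two_three]; norm_num

theorem ackA_three_three : ackA 3 3 = 65536 := by
  have : ackA 3 2 = 4 := by simp [ackA]
  rw [ackA, this, ackA_two_four]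

/-- The recursion for `hopDepth` exponentiates its previous value; the tower growth of `ackA 2`
absorbs this together with the additive offsets. -/
theorem exp_add_le_ackA_two (y : ℕ) : 2 ^ (y + 6) + 3 + (y + 5) ≤ ackA 2 (y + 4) := by
  induction y with
  | zero => rw [ackA_two_four]; norm_num
  | succ y ih =>
    have h : 2 * ackA 2 (y + 4) ≤ ackA 2 (y + 4 + 1) := two_mul_ackA_le_ackA_succ 1 (y + 4)
    have : 2 ^ (y + 1 + 6) = 2 * 2 ^ (y + 6) := by ring
    have e : y + 1 + 4 = y + 4 + 1 := by ring
    rw [e, this]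
    omega

theorem mul_le_ackA_three (M : ℕ) : 20 * (M + 1) ≤ ackA 3 (4 * M + 3) := by
  induction M with
  | zero => rw [ackA_three_three]; norm_num
  | succ M ih =>
    have h : 2 * ackA 3 (4 * M + 3) ≤ ackA 3 (4 * M + 3 + 1) :=
      two_mul_ackA_le_ackA_succ 2 (4 * M + 3)
    have h' := (ackA_strictMono 3).monotone (show 4 * M + 3 + 1 ≤ 4 * (M + 1) + 3 by omega)
    omega

/-! ### The depth that forces many edges -/

/-- A graph with `2 * i`-hop walks between the leaves of a binary tree of depth at least
`hopDepth i j` has average degree proportional to `j`, see `two_mul_card_le_of_isHopSpanner`. -/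
def hopDepth : ℕ → ℕ → ℕ
  | 0, _ => 1
  | _ + 1, 0 => 0
  | i + 1, j + 1 => hopDepth (i + 1) j + hopDepth i (2 ^ (hopDepth (i + 1) j + 1))

/-- Each increment of `i` costs two Ackermann levels: one for iterating over `j`, one to absorb the
exponential in the recursion. -/
theorem hopDepth_le_ackA (i j : ℕ) : hopDepth i j ≤ ackA (2 * i + 1) (j + 3) := by
  induction i generalizing j with
  | zero =>
    rw [hopDepth]
    exact ackA_pos_of_succ _ _
  | succ i ih =>
    induction j with
    | zero => simp [hopDepth]
    | succ j ihj =>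
      rw [hopDepth]
      -- The shift `j + 3` makes the value large enough to be written `z + 5`, as
      -- `exp_add_le_ackA_two` requires.
      have hy : 16 ≤ ackA (2 * (i + 1) + 1) (j + 3) := by
        rw [← ackA_two_three]
        exact (ackA_mono_left (by omega) 3).trans ((ackA_strictMono _).monotone (by omega))
      obtain ⟨z, hz⟩ : ∃ z, ackA (2 * (i + 1) + 1) (j + 3) = z + 5 :=
        ⟨_, (Nat.sub_add_cancel (by omega)).symm⟩
      have hstep : ackA (2 * (i + 1) + 1) (j + 1 + 3)
          = ackA (2 * i + 1) (ackA (2 * i + 2) (z + 4)) := by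
        rw [show j + 1 + 3 = (j + 3) + 1 by ring, ackA, hz]
        rw [show 2 * (i + 1) = 2 * i + 1 + 1 by ring, ackA]
      rw [hstep]
      rw [hz] at ihj
      have hp : 2 ^ (hopDepth (i + 1) j + 1) ≤ 2 ^ (z + 6) :=
        Nat.pow_le_pow_right (by norm_num) (by omega)
      calc hopDepth (i + 1) j + hopDepth i (2 ^ (hopDepth (i + 1) j + 1))
          ≤ ackA (2 * i + 1) (2 ^ (hopDepth (i + 1) j + 1) + 3) + (z + 5) := by
            have := ih (2 ^ (hopDepth (i + 1) j + 1))
            omega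
        _ ≤ ackA (2 * i + 1) (2 ^ (hopDepth (i + 1) j + 1) + 3 + (z + 5)) := ackA_add_le _ _ _
        _ ≤ ackA (2 * i + 1) (ackA (2 * i + 2) (z + 4)) := by
            refine (ackA_strictMono _).monotone ?_
            have h1 := exp_add_le_ackA_two z
            have h2 := ackA_mono_left (show 2 ≤ 2 * i + 2 by omega) (z + 4)
            omega

theorem hopDepth_le_ackA_four_mul (i : ℕ) {M : ℕ} (hM : 1 ≤ M) :
    hopDepth i (16 * M + 1) ≤ ackA (2 * i + 3) (4 * M) := by
  obtain ⟨M, rfl⟩ := Nat.exists_eq_add_of_le' hM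
  rw [show 4 * (M + 1) = 4 * M + 3 + 1 by ring, ackA]
  refine (hopDepth_le_ackA _ _).trans ((ackA_mono_left (by omega) _).trans
    ((ackA_strictMono _).monotone ?_))
  have h1 := mul_le_ackA_three M
  have h2 := ackA_mono_left (show 3 ≤ 2 * i + 2 + 1 by omega) (4 * M + 3)
  omega

/-! ### Hop spanners of dyadic hierarchies -/

/-- Two vertices are equal or joined by an edge of `E`. -/
def IsHop (E : Finset (ℕ × ℕ)) (x y : ℕ) : Prop :=
  x = y ∨ (x, y) ∈ E ∨ (y, x) ∈ E

/-- Any two elements of `S` in a common dyadic interval of length `2 ^ l`, with `l ≤ h`, are joined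
by a walk of at most `k` edges of `E` inside this interval. -/
def IsHopSpanner (h k : ℕ) (S : Finset ℕ) (E : Finset (ℕ × ℕ)) : Prop :=
  ∀ p ∈ S, ∀ q ∈ S, ∀ l ≤ h, p / 2 ^ l = q / 2 ^ l →
    ∃ f : ℕ → ℕ, f 0 = p ∧ f k = q ∧ (∀ i < k, IsHop E (f i) (f (i + 1))) ∧
      ∀ i ≤ k, f i / 2 ^ l = p / 2 ^ l

theorem IsHopSpanner.restrict {h k b : ℕ} {S : Finset ℕ} {E : Finset (ℕ × ℕ)}
    (H : IsHopSpanner h k S E) (hb : b ≤ h) (c : ℕ) :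
    IsHopSpanner b k (S.filter fun x => x / 2 ^ b = c)
      (E.filter fun e => e.1 / 2 ^ b = c ∧ e.2 / 2 ^ b = c) := by
  intro p hp q hq l hl hpq
  rw [Finset.mem_filter] at hp hq
  obtain ⟨f, h0, hk, hf, hfl⟩ := H p hp.1 q hq.1 l (hl.trans hb) hpq
  have hc : ∀ i ≤ k, f i / 2 ^ b = c := by
    intro i hi
    rw [← hp.2, ← Nat.add_sub_cancel' hl, pow_add, ← Nat.div_div_eq_div_mul,
      ← Nat.div_div_eq_div_mul, hfl i hi]
  refine ⟨f, h0, hk, fun i hi => ?_, hfl⟩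
  have h1 := hc i hi.le
  have h2 := hc (i + 1) hi
  rcases hf i hi with e | e | e
  · exact Or.inl e
  · exact Or.inr (Or.inl (Finset.mem_filter.2 ⟨e, h1, h2⟩))
  · exact Or.inr (Or.inr (Finset.mem_filter.2 ⟨e, h2, h1⟩))

/-- Contracting the dyadic intervals of length `2 ^ b` saves the first and the last edge of the walks
between vertices without edges leaving their interval. -/
theorem IsHopSpanner.contract {h k b : ℕ} {S T : Finset ℕ} {E : Finset (ℕ × ℕ)}
    (H : IsHopSpanner h (k + 2) S E) (hb : b ≤ h) (hTS : T ⊆ S)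
    (hT : ∀ x ∈ T, ∀ e ∈ E, e.1 / 2 ^ b ≠ e.2 / 2 ^ b → x ≠ e.1 ∧ x ≠ e.2) :
    IsHopSpanner (h - b) k (T.image fun x => x / 2 ^ b)
      ((E.filter fun e => e.1 / 2 ^ b ≠ e.2 / 2 ^ b).image
        fun e => (e.1 / 2 ^ b, e.2 / 2 ^ b)) := by
  intro P hP Q hQ l hl hPQ
  obtain ⟨p, hp, rfl⟩ := Finset.mem_image.1 hP
  obtain ⟨q, hq, rfl⟩ := Finset.mem_image.1 hQ
  simp only [Nat.div_div_eq_div_mul, ← pow_add] at hPQ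
  -- Level `l` after contraction is level `b + l` before it.
  obtain ⟨f, h0, hk, hf, hfl⟩ := H p (hTS hp) q (hTS hq) (b + l) (by omega) hPQ
  have key : ∀ x y, (x ∈ T ∨ y ∈ T) → IsHop E x y → x / 2 ^ b = y / 2 ^ b := by
    intro x y hxy e
    by_contra hne
    rcases e with e | e | e
    · exact hne (by rw [e])
    · rcases hxy with hx | hy
      · exact (hT x hx _ e hne).1 rfl
      · exact (hT y hy _ e hne).2 rfl
    · rcases hxy with hx | hy
      · exact (hT x hx _ e (Ne.symm hne)).2 rfl
      · exact (hT y hy _ e (Ne.symm hne)).1 rfl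
  refine ⟨fun i => f (i + 1) / 2 ^ b, ?_, ?_, fun i hi => ?_, fun i hi => ?_⟩
  · have := key _ _ (Or.inl (h0 ▸ hp)) (hf 0 (by omega))
    simpa [h0] using this.symm
  · have := key _ _ (Or.inr (hk ▸ hq)) (hf (k + 1) (by omega))
    simpa [hk] using this
  · by_cases heq : f (i + 1) / 2 ^ b = f (i + 1 + 1) / 2 ^ b
    · exact Or.inl heq
    · rcases hf (i + 1) (by omega) with e | e | e
      · exact absurd (by rw [e]) heq
      · exact Or.inr (Or.inl (Finset.mem_image.2 ⟨_, Finset.mem_filter.2 ⟨e, heq⟩, rfl⟩))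
      · exact Or.inr (Or.inr (Finset.mem_image.2 ⟨_, Finset.mem_filter.2 ⟨e, Ne.symm heq⟩, rfl⟩))
  · simpa only [Nat.div_div_eq_div_mul, ← pow_add] using hfl (i + 1) (by omega)

theorem card_filter_div_eq_le (S : Finset ℕ) {d : ℕ} (hd : 0 < d) (c : ℕ) :
    (S.filter fun x => x / d = c).card ≤ d := by
  calc (S.filter fun x => x / d = c).card ≤ (Finset.Ico (c * d) (c * d + d)).card := by
        refine Finset.card_le_card fun x hx => ?_
        have := (Finset.mem_filter.1 hx).2
        rw [Nat.div_eq_iff hd] at this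
        rw [Finset.mem_Ico]
        omega
    _ = d := by simp

theorem card_image_div_le {h b a : ℕ} {S : Finset ℕ} (hb : b ≤ h) (hS : ∀ x ∈ S, x / 2 ^ h = a) :
    (S.image fun x => x / 2 ^ b).card ≤ 2 ^ (h - b) := by
  have : (S.image fun x => x / 2 ^ b).filter (fun y => y / 2 ^ (h - b) = a)
      = S.image fun x => x / 2 ^ b := by
    refine Finset.filter_true_of_mem fun y hy => ?_
    obtain ⟨x, hx, rfl⟩ := Finset.mem_image.1 hy
    rw [Nat.div_div_eq_div_mul, ← pow_add, Nat.add_sub_cancel' hb, hS x hx]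
  rw [← this]
  exact card_filter_div_eq_le _ (by positivity) _

theorem card_le_mul_card_image_div (S : Finset ℕ) {d : ℕ} (hd : 0 < d) :
    S.card ≤ d * (S.image fun x => x / d).card :=
  Finset.card_le_mul_card_image S d fun c _ => card_filter_div_eq_le S hd c

/-- Few edges of a hop spanner leave the dyadic intervals of length `2 ^ b`, only if few edges are
needed after contracting these intervals. -/
theorem card_le_of_contract {h k b a : ℕ} {S : Finset ℕ} {E : Finset (ℕ × ℕ)}
    (H : IsHopSpanner h (k + 2) S E) (hb : b ≤ h) (hS : ∀ x ∈ S, x / 2 ^ h = a)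
    (IH : ∀ (S' : Finset ℕ) (E' : Finset (ℕ × ℕ)), (∀ x ∈ S', x / 2 ^ (h - b) = a) →
      IsHopSpanner (h - b) k S' E' →
      2 * 2 ^ (b + 1) * S'.card ≤ 8 * E'.card + 2 ^ (b + 1) * 2 ^ (h - b)) :
    2 * S.card ≤ 8 * (E.filter fun e => e.1 / 2 ^ b ≠ e.2 / 2 ^ b).card + 2 ^ h := by
  -- `G` is the set of crossing edges, `U` their endpoints, and `T` the vertices whose edges all
  -- stay in their block.
  set G := E.filter fun e => e.1 / 2 ^ b ≠ e.2 / 2 ^ b with hG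
  set U := G.image Prod.fst ∪ G.image Prod.snd with hU
  set T := S \ U with hT
  have hUcard : U.card ≤ 2 * G.card := by
    have h1 := Finset.card_union_le (G.image Prod.fst) (G.image Prod.snd)
    have h2 := Finset.card_image_le (s := G) (f := Prod.fst)
    have h3 := Finset.card_image_le (s := G) (f := Prod.snd)
    rw [hU]
    omega
  have hST : S.card ≤ T.card + U.card := by
    have := Finset.le_card_sdiff U S
    rw [hT]
    omega
  have hcon := H.contract (T := T) hb Finset.sdiff_subset fun x hx e he hne => by
    have hxU := (Finset.mem_sdiff.1 hx).2
    have heG : e ∈ G := Finset.mem_filter.2 ⟨he, hne⟩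
    constructor
    · rintro rfl
      exact hxU (Finset.mem_union_left _ (Finset.mem_image_of_mem _ heG))
    · rintro rfl
      exact hxU (Finset.mem_union_right _ (Finset.mem_image_of_mem _ heG))
  have hbound := IH _ _ (fun y hy => by
    obtain ⟨x, hx, rfl⟩ := Finset.mem_image.1 hy
    rw [Nat.div_div_eq_div_mul, ← pow_add, Nat.add_sub_cancel' hb]
    exact hS x (Finset.mem_sdiff.1 hx).1) hcon
  rw [← hG] at hbound
  have hGim := Finset.card_image_le (s := G) (f := fun e => (e.1 / 2 ^ b, e.2 / 2 ^ b))
  have hTim := card_le_mul_card_image_div T (show 0 < 2 ^ b by positivity)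
  have hpow : 2 ^ (b + 1) * 2 ^ (h - b) = 2 * 2 ^ h := by
    rw [← pow_add, show b + 1 + (h - b) = h + 1 by omega, pow_succ, mul_comm]
  have h4 : 2 * 2 ^ (b + 1) * (T.image fun x => x / 2 ^ b).card
      = 4 * (2 ^ b * (T.image fun x => x / 2 ^ b).card) := by ring
  rw [hpow, h4] at hbound
  omega

/-- The bound is additive over blocks: edges inside different blocks are distinct, and the error
terms `j * 2 ^ b` sum to at most `j * 2 ^ h`. -/
theorem card_le_of_restrict {h k b a j : ℕ} {S : Finset ℕ} {E : Finset (ℕ × ℕ)}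
    (H : IsHopSpanner h k S E) (hb : b ≤ h) (hS : ∀ x ∈ S, x / 2 ^ h = a)
    (IH : ∀ (c : ℕ) (S' : Finset ℕ) (E' : Finset (ℕ × ℕ)), (∀ x ∈ S', x / 2 ^ b = c) →
      IsHopSpanner b k S' E' → 2 * j * S'.card ≤ 8 * E'.card + j * 2 ^ b) :
    2 * j * S.card ≤ 8 * (E.filter fun e => e.1 / 2 ^ b = e.2 / 2 ^ b).card + j * 2 ^ h := by
  set C := S.image fun x => x / 2 ^ b with hC
  have hsum : S.card = ∑ c ∈ C, (S.filter fun x => x / 2 ^ b = c).card :=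
    Finset.card_eq_sum_card_image _ _
  have hE : ∑ c ∈ C, (E.filter fun e => e.1 / 2 ^ b = c ∧ e.2 / 2 ^ b = c).card
      ≤ (E.filter fun e => e.1 / 2 ^ b = e.2 / 2 ^ b).card := by
    rw [← Finset.card_biUnion]
    · refine Finset.card_le_card fun e he => ?_
      obtain ⟨c, -, he⟩ := Finset.mem_biUnion.1 he
      rw [Finset.mem_filter] at he ⊢
      exact ⟨he.1, he.2.1.trans he.2.2.symm⟩
    · intro c _ c' _ hne
      refine Finset.disjoint_left.2 fun e he he' => hne ?_
      rw [Finset.mem_filter] at he he'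
      exact he.2.1.symm.trans he'.2.1
  have hCcard : C.card * 2 ^ b ≤ 2 ^ h := by
    calc C.card * 2 ^ b ≤ 2 ^ (h - b) * 2 ^ b := Nat.mul_le_mul_right _ (card_image_div_le hb hS)
      _ = 2 ^ h := by rw [← pow_add, Nat.sub_add_cancel hb]
  calc 2 * j * S.card = ∑ c ∈ C, 2 * j * (S.filter fun x => x / 2 ^ b = c).card := by
        rw [hsum, Finset.mul_sum]
    _ ≤ ∑ c ∈ C, (8 * (E.filter fun e => e.1 / 2 ^ b = c ∧ e.2 / 2 ^ b = c).card + j * 2 ^ b) :=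
        Finset.sum_le_sum fun c _ => IH c _ _ (fun x hx => (Finset.mem_filter.1 hx).2)
          (H.restrict hb c)
    _ = 8 * ∑ c ∈ C, (E.filter fun e => e.1 / 2 ^ b = c ∧ e.2 / 2 ^ b = c).card
          + j * (C.card * 2 ^ b) := by
        rw [Finset.sum_add_distrib, Finset.mul_sum, Finset.sum_const, smul_eq_mul]
        ring
    _ ≤ _ := Nat.add_le_add (Nat.mul_le_mul_left _ hE) (Nat.mul_le_mul_left _ hCcard)

/-- A `2 * i`-hop spanner of a set `S` in a dyadic interval of length `2 ^ h`, with
`hopDepth i j ≤ h`, has at least `(j / 4) * (|S| - 2 ^ h / 2)` edges. -/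
theorem two_mul_card_le_of_isHopSpanner (i j : ℕ) {h a : ℕ} (hh : hopDepth i j ≤ h)
    {S : Finset ℕ} {E : Finset (ℕ × ℕ)} (hS : ∀ x ∈ S, x / 2 ^ h = a)
    (H : IsHopSpanner h (2 * i) S E) :
    2 * j * S.card ≤ 8 * E.card + j * 2 ^ h := by
  induction i generalizing j h a S E with
  | zero =>
    rw [hopDepth] at hh
    -- With no hops all elements of `S` coincide.
    have hcard : S.card ≤ 1 := by
      refine Finset.card_le_one.2 fun p hp q hq => ?_
      obtain ⟨f, h0, hk, -⟩ := H p hp q hq h le_rfl ((hS p hp).trans (hS q hq).symm)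
      exact h0.symm.trans hk
    have hpow : 2 ^ 1 ≤ 2 ^ h := Nat.pow_le_pow_right (by norm_num) hh
    calc 2 * j * S.card ≤ 2 * j * 1 := Nat.mul_le_mul_left _ hcard
      _ = j * 2 ^ 1 := by ring
      _ ≤ j * 2 ^ h := Nat.mul_le_mul_left _ hpow
      _ ≤ _ := Nat.le_add_left _ _
  | succ i ih =>
    induction j generalizing h a S E with
    | zero => simp
    | succ j ihj =>
      rw [hopDepth] at hh
      set b := hopDepth (i + 1) j with hbdef
      have hb : b ≤ h := by omega
      have hin := card_le_of_restrict H hb hS fun c S' E' hS' H' => ihj le_rfl hS' H'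
      -- Contraction can shrink the vertex count by a factor `2 ^ b`; density `2 ^ (b + 1)` makes up
      -- for it.
      have hout := card_le_of_contract (k := 2 * i) H hb hS fun S' E' hS' H' =>
        ih (2 ^ (b + 1)) (by omega) hS' H'
      have hsplit := Finset.card_filter_add_card_filter_not (s := E)
        (fun e => e.1 / 2 ^ b = e.2 / 2 ^ b)
      have e1 : 2 * (j + 1) * S.card = 2 * j * S.card + 2 * S.card := by ring
      have e2 : (j + 1) * 2 ^ h = j * 2 ^ h + 2 ^ h := by ring
      rw [e1, e2, ← hsplit]
      simp only [ne_eq] at hout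
      omega

/-! ### Points on the line -/

/-- The number whose digits in base `R` are the binary digits of `x`. -/
def spread (R x : ℕ) : ℕ :=
  if x = 0 then 0 else R * spread R (x / 2) + x % 2

theorem spread_eq (R x : ℕ) : spread R x = R * spread R (x / 2) + x % 2 := by
  rw [spread]
  split_ifs with h
  · subst h
    rw [spread]
    simp
  · rfl

theorem spread_injective {R : ℕ} (hR : 2 ≤ R) : Function.Injective (spread R) := by
  intro x
  induction x using Nat.strong_induction_on with
  | _ x ih =>
    intro y hxy
    rw [spread_eq R x, spread_eq R y] at hxy
    have hx : x % 2 < R := by omega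
    have hy : y % 2 < R := by omega
    have hmod : x % 2 = y % 2 := by
      have := congrArg (· % R) hxy
      simpa [Nat.mul_add_mod, Nat.mod_eq_of_lt hx, Nat.mod_eq_of_lt hy] using this
    have hdiv : spread R (x / 2) = spread R (y / 2) := by
      rw [hmod] at hxy
      exact Nat.eq_of_mul_eq_mul_left (by omega) (Nat.add_right_cancel hxy)
    -- Halving does not decrease `0`, so that case uses positivity of `spread` instead of induction.
    rcases Nat.eq_zero_or_pos x with rfl | hpos
    · rcases Nat.eq_zero_or_pos y with rfl | hy0
      · rfl
      · exfalso
        have key : ∀ z, 0 < z → 0 < spread R z := by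
          intro z
          induction z using Nat.strong_induction_on with
          | _ z ihz =>
            intro hz
            rw [spread_eq]
            rcases Nat.eq_zero_or_pos (z / 2) with h0 | h0
            · omega
            · have := ihz (z / 2) (by omega) h0
              positivity
        have h1 : 0 < y / 2 := by omega
        have h2 := key _ h1
        rw [← hdiv, show 0 / 2 = 0 by rfl, spread] at h2
        simp at h2
    · have := ih (x / 2) (by omega) hdiv
      omega

theorem abs_mod_two_sub_le (p q : ℕ) : |((p % 2 : ℕ) : ℝ) - ((q % 2 : ℕ) : ℝ)| ≤ 1 := by
  rcases Nat.mod_two_eq_zero_or_one p with h | h <;>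
    rcases Nat.mod_two_eq_zero_or_one q with h' | h' <;> simp [h, h']

theorem spread_sub_spread (R p q : ℕ) :
    (spread R p : ℝ) - spread R q = R * ((spread R (p / 2) : ℝ) - spread R (q / 2))
      + (((p % 2 : ℕ) : ℝ) - ((q % 2 : ℕ) : ℝ)) := by
  rw [spread_eq R p, spread_eq R q]
  push_cast
  ring

/-- The worst case is `1 + R + ⋯ + R ^ (l - 1)`, multiplied by `R - 1` to avoid division. -/
theorem abs_spread_sub_le {R : ℕ} (hR : 2 ≤ R) (l : ℕ) {p q : ℕ} (h : p / 2 ^ l = q / 2 ^ l) :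
    ((R : ℝ) - 1) * |(spread R p : ℝ) - spread R q| ≤ (R : ℝ) ^ l - 1 := by
  have hR' : (2 : ℝ) ≤ R := by exact_mod_cast hR
  induction l generalizing p q with
  | zero =>
    simp only [pow_zero, Nat.div_one] at h
    simp [h]
  | succ l ih =>
    rw [pow_succ', ← Nat.div_div_eq_div_mul, ← Nat.div_div_eq_div_mul] at h
    have h1 := ih h
    rw [spread_sub_spread]
    have h2 := abs_add_le ((R : ℝ) * ((spread R (p / 2) : ℝ) - spread R (q / 2)))
      (((p % 2 : ℕ) : ℝ) - ((q % 2 : ℕ) : ℝ))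
    rw [abs_mul, abs_of_nonneg (show (0 : ℝ) ≤ R by linarith)] at h2
    have h3 := abs_mod_two_sub_le p q
    have h4 := mul_le_mul_of_nonneg_left (h2.trans (add_le_add_right h3 _))
      (show (0 : ℝ) ≤ R - 1 by linarith)
    have h5 := mul_le_mul_of_nonneg_left h1 (show (0 : ℝ) ≤ R by linarith)
    rw [pow_succ]
    linarith

/-- A differing digit at position `l` or above contributes at least `R ^ l`, of which the lower
digits cancel at most `1 + R + ⋯ + R ^ (l - 1)`. -/
theorem le_abs_spread_sub {R : ℕ} (hR : 2 ≤ R) (l : ℕ) {p q : ℕ} (h : p / 2 ^ l ≠ q / 2 ^ l) :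
    ((R : ℝ) - 2) * (R : ℝ) ^ l + 1 ≤ ((R : ℝ) - 1) * |(spread R p : ℝ) - spread R q| := by
  have hR' : (2 : ℝ) ≤ R := by exact_mod_cast hR
  induction l generalizing p q with
  | zero =>
    simp only [pow_zero, Nat.div_one] at h
    have hne : ((spread R p : ℤ) - spread R q) ≠ 0 := by
      rw [sub_ne_zero]
      exact_mod_cast (spread_injective hR).ne h
    have h1 : (1 : ℝ) ≤ |(spread R p : ℝ) - spread R q| := by
      exact_mod_cast Int.one_le_abs hne
    have := mul_le_mul_of_nonneg_left h1 (show (0 : ℝ) ≤ R - 1 by linarith)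
    rw [pow_zero]
    linarith
  | succ l ih =>
    rw [pow_succ', ← Nat.div_div_eq_div_mul, ← Nat.div_div_eq_div_mul] at h
    have h1 := ih h
    rw [spread_sub_spread]
    have h2 := abs_sub_abs_le_abs_sub ((R : ℝ) * ((spread R (p / 2) : ℝ) - spread R (q / 2)))
      (-(((p % 2 : ℕ) : ℝ) - ((q % 2 : ℕ) : ℝ)))
    rw [abs_mul, abs_of_nonneg (show (0 : ℝ) ≤ R by linarith), abs_neg, sub_neg_eq_add] at h2
    have h3 := abs_mod_two_sub_le p q
    have h4 := mul_le_mul_of_nonneg_left ((sub_le_sub_left h3 _).trans h2)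
      (show (0 : ℝ) ≤ R - 1 by linarith)
    have h5 := mul_le_mul_of_nonneg_left h1 (show (0 : ℝ) ≤ R by linarith)
    rw [pow_succ]
    linarith

/-- Distinct dyadic intervals of the same length are far apart compared to their diameters. -/
theorem div_two_pow_eq_of_abs_spread_sub_le {R : ℕ} {t : ℝ} (ht : 0 ≤ t) (hR : 2 * t + 2 ≤ R)
    {l p q v : ℕ} (hpq : p / 2 ^ l = q / 2 ^ l)
    (hv : |(spread R p : ℝ) - spread R v| ≤ 2 * (t * |(spread R p : ℝ) - spread R q|)) :
    v / 2 ^ l = p / 2 ^ l := by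
  by_contra hne
  have hR' : (2 : ℝ) ≤ R := by linarith
  have hR2 : 2 ≤ R := by exact_mod_cast hR'
  have h1 := abs_spread_sub_le hR2 l hpq
  have h2 := le_abs_spread_sub hR2 l (Ne.symm hne)
  have h3 := mul_le_mul_of_nonneg_left hv (show (0 : ℝ) ≤ R - 1 by linarith)
  have h4 := mul_le_mul_of_nonneg_left h1 (show (0 : ℝ) ≤ 2 * t by linarith)
  have h5 : 2 * t * (R : ℝ) ^ l ≤ ((R : ℝ) - 2) * (R : ℝ) ^ l :=
    mul_le_mul_of_nonneg_right (by linarith) (by positivity)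
  linarith

/-! ### From spanners to hop spanners -/

theorem dist_getVert_le_walkWeight {P : Type*} [MetricSpace P] {V : Set P} {H : SimpleGraph V}
    {u v : V} (w : H.Walk u v) (i : ℕ) : dist (u : P) (w.getVert i : P) ≤ walkWeight w := by
  induction w generalizing i with
  | nil => simp [walkWeight]
  | @cons a b c hab w ih =>
    have hcons : walkWeight (SimpleGraph.Walk.cons hab w) = dist (a : P) (b : P) + walkWeight w := by
      simp [walkWeight]
    rw [hcons]
    cases i with
    | zero =>
      have h0 : 0 ≤ walkWeight w := dist_nonneg.trans (ih 0)
      simp only [SimpleGraph.Walk.getVert_zero, dist_self]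
      positivity
    | succ i =>
      rw [SimpleGraph.Walk.getVert_cons_succ]
      exact (dist_triangle _ (b : P) _).trans (add_le_add_right (ih i) _)

theorem exists_walk_length_le_of_spannerDiameter_le {P : Type*} [MetricSpace P] {V : Set P}
    {H : SimpleGraph V} {t : ℝ} {X : Set P} {k : ℕ} (hk : spannerDiameter t X H ≤ (k : ℕ∞))
    {p q : V} (hp : (p : P) ∈ X) (hq : (q : P) ∈ X) (hpq : p ≠ q) :
    ∃ w : H.Walk p q, IsSpannerPath t w ∧ w.length ≤ k := by
  have h1 : ⨅ (w : H.Walk p q) (_ : IsSpannerPath t w), (w.length : ℕ∞) ≤ (k : ℕ∞) := by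
    refine le_trans ?_ hk
    unfold spannerDiameter
    refine le_trans ?_ (le_iSup _ p)
    refine le_trans ?_ (le_iSup _ q)
    refine le_trans ?_ (le_iSup _ hp)
    refine le_trans ?_ (le_iSup _ hq)
    exact le_iSup (fun _ : p ≠ q => ⨅ (w : H.Walk p q) (_ : IsSpannerPath t w), (w.length : ℕ∞)) hpq
  by_contra! hcon
  have h2 : ((k + 1 : ℕ) : ℕ∞) ≤ ⨅ (w : H.Walk p q) (_ : IsSpannerPath t w), (w.length : ℕ∞) :=
    le_iInf₂ fun w hw => by exact_mod_cast hcon w hw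
  have h3 := h2.trans h1
  rw [Nat.cast_le] at h3
  omega

theorem exists_isHopSpanner {P : Type*} [MetricSpace P] {V : Set P} {H : SimpleGraph V} {t : ℝ}
    {R N h k m : ℕ} (ht : 0 ≤ t) (hR : 2 * t + 2 ≤ R) (x : ℕ → V)
    (hx : ∀ i < N, ∀ j < N, dist (x i : P) (x j) = |(spread R i : ℝ) - spread R j|)
    (hN : 0 < N)
    (hwalk : ∀ p < N, ∀ q < N, ∃ w : H.Walk (x p) (x q),
      walkWeight w ≤ t * dist (x p : P) (x q) ∧ w.length ≤ k)
    (hm : H.edgeSet.encard ≤ (m : ℕ∞)) :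
    ∃ E : Finset (ℕ × ℕ), E.card ≤ m ∧ IsHopSpanner h k (Finset.range N) E := by
  classical
  have hnear : ∀ v : V, ∃ c ∈ Finset.range N, ∀ p ∈ Finset.range N,
      dist (v : P) (x c) ≤ dist (v : P) (x p) := fun v =>
    Finset.exists_min_image _ _ ⟨0, Finset.mem_range.2 hN⟩
  choose c hcN hc using hnear
  have hfin : H.edgeSet.Finite := Set.finite_of_encard_le_coe hm
  have hself : ∀ p < N, c (x p) = p := by
    intro p hp
    have h1 := hc (x p) p (Finset.mem_range.2 hp)
    rw [dist_self, hx _ hp _ (Finset.mem_range.1 (hcN _))] at h1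
    have h2 : spread R p = spread R (c (x p)) := by
      exact_mod_cast sub_eq_zero.1 (abs_nonpos_iff.1 h1)
    exact (spread_injective (by
      have : (2 : ℝ) ≤ R := by linarith
      exact_mod_cast this) h2).symm
  -- `e.out` orients each edge arbitrarily, which is harmless because `IsHop` is symmetric.
  refine ⟨hfin.toFinset.image fun e => (c e.out.1, c e.out.2), ?_, ?_⟩
  · refine Finset.card_image_le.trans ?_
    rw [hfin.encard_eq_coe_toFinset_card] at hm
    exact_mod_cast hm
  · intro p hp q hq l _ hpq
    rw [Finset.mem_range] at hp hq
    obtain ⟨w, hw, hlen⟩ := hwalk p hp q hq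
    refine ⟨fun i => c (w.getVert i), ?_, ?_, fun i _ => ?_, fun i _ => ?_⟩
    · simp [hself p hp]
    · simp [w.getVert_of_length_le hlen, hself q hq]
    · rcases lt_or_ge i w.length with hi | hi
      · have hadj := w.adj_getVert_succ hi
        set a := w.getVert i
        set b := w.getVert (i + 1)
        have hmem : s(a, b) ∈ hfin.toFinset := by simpa using hadj
        have hout : s((s(a, b)).out.1, (s(a, b)).out.2) = s(a, b) := Quot.out_eq _
        have himg := Finset.mem_image_of_mem (fun e : Sym2 V => (c e.out.1, c e.out.2)) hmem
        rcases Sym2.eq_iff.1 hout with ⟨h1, h2⟩ | ⟨h1, h2⟩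
        · rw [h1, h2] at himg
          exact Or.inr (Or.inl himg)
        · rw [h1, h2] at himg
          exact Or.inr (Or.inr himg)
      · refine Or.inl ?_
        simp only
        rw [w.getVert_of_length_le hi, w.getVert_of_length_le (by omega)]
    -- A path vertex is within `t‖p - q‖` of `p`, and its nearest point is no farther from it than
    -- `p` is, whence the factor 2.
    · refine div_two_pow_eq_of_abs_spread_sub_le ht hR hpq ?_
      rw [← hx _ hp _ (Finset.mem_range.1 (hcN _)), ← hx _ hp _ hq]
      have h1 := dist_triangle (x p : P) (w.getVert i : P) (x (c (w.getVert i)) : P)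
      have h2 := hc (w.getVert i) p (Finset.mem_range.2 hp)
      rw [dist_comm _ (x p : P)] at h2
      have h3 := dist_getVert_le_walkWeight w i
      linarith

/-! ### The lower bound -/

/-- A graph in which any two of the first `n` points of a `spread` sequence are joined by a `t`-spanner
walk of at most `k` edges has too many edges for `k` to be much smaller than `invAck m n`. -/
theorem invAck_le_add_four {P : Type*} [MetricSpace P] {V : Set P} {H : SimpleGraph V} {t : ℝ}
    {R n k m : ℕ} (hn : 2 ≤ n) (hm1 : 1 ≤ m) (ht : 0 ≤ t) (hR : 2 * t + 2 ≤ R) (x : ℕ → V)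
    (hx : ∀ i < n, ∀ j < n, dist (x i : P) (x j) = |(spread R i : ℝ) - spread R j|)
    (hwalk : ∀ p < n, ∀ q < n, ∃ w : H.Walk (x p) (x q),
      walkWeight w ≤ t * dist (x p : P) (x q) ∧ w.length ≤ k)
    (hm : H.edgeSet.encard ≤ (m : ℕ∞)) :
    invAck m n ≤ k + 4 := by
  set h := Nat.log 2 n with hh
  set i := (k + 1) / 2 with hi
  set M := ⌈(m : ℝ) / (n : ℝ)⌉₊ with hM
  have hNn : 2 ^ h ≤ n := Nat.pow_log_le_self 2 (by omega)
  have hnN : n < 2 ^ (h + 1) := Nat.lt_pow_succ_log_self (by norm_num) n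
  have hn0 : (0 : ℝ) < n := by
    have : 0 < n := by omega
    exact_mod_cast this
  have hm0 : (0 : ℝ) < m := by exact_mod_cast hm1
  have hM1 : 1 ≤ M := Nat.ceil_pos.2 (by positivity)
  have hmM : m ≤ M * n := by
    have h1 := Nat.le_ceil ((m : ℝ) / (n : ℝ))
    rw [div_le_iff₀ hn0] at h1
    exact_mod_cast h1
  obtain ⟨E, hEm, hE⟩ := exists_isHopSpanner (h := h) (k := 2 * i) (N := 2 ^ h) ht hR x
    (fun i hi j hj => hx i (by omega) j (by omega)) (by positivity)
    (fun p hp q hq => by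
      obtain ⟨w, hw, hlen⟩ := hwalk p (by omega) q (by omega)
      exact ⟨w, hw, by omega⟩) hm
  -- Otherwise `(16M + 1) * 2 ^ h ≤ 8m`, while `m ≤ M * n ≤ 2M * 2 ^ h`.
  have hdepth : h < hopDepth i (16 * M + 1) := by
    by_contra hcon
    have hcore := two_mul_card_le_of_isHopSpanner i (16 * M + 1) (a := 0) (not_lt.1 hcon)
      (fun x hx => Nat.div_eq_of_lt (Finset.mem_range.1 hx)) hE
    rw [Finset.card_range] at hcore
    have h1 : M * n ≤ M * 2 ^ (h + 1) := Nat.mul_le_mul_left _ hnN.le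
    have h2 : M * 2 ^ (h + 1) = 2 * (M * 2 ^ h) := by ring
    have h3 : 2 * (16 * M + 1) * 2 ^ h = 32 * (M * 2 ^ h) + 2 * 2 ^ h := by ring
    have h4 : (16 * M + 1) * 2 ^ h = 16 * (M * 2 ^ h) + 2 ^ h := by ring
    have h5 : 0 < 2 ^ h := by positivity
    omega
  have hack := hopDepth_le_ackA_four_mul i hM1
  have hlog : Real.logb 2 n ≤ (ackA (2 * i + 3) (4 * M) : ℝ) := by
    have h1 : Real.logb 2 n ≤ ((h + 1 : ℕ) : ℝ) := by
      rw [Real.logb_le_iff_le_rpow (by norm_num) hn0, Real.rpow_natCast]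
      exact_mod_cast hnN.le
    refine h1.trans ?_
    exact_mod_cast Nat.succ_le_of_lt (hdepth.trans_le hack)
  have hle : invAck m n ≤ 2 * i + 3 := Nat.sInf_le ⟨by omega, hlog⟩
  omega

theorem mainTheorem4 :
    ∃ c : ℝ, 0 < c ∧
      ∀ ε : ℝ, 0 < ε → ∀ n : ℕ, 2 ≤ n →
        ∃ X : Finset ℝ, X.card = n ∧
          ∀ (d : ℕ) [NeZero d] (V : Set (EuclideanSpace ℝ (Fin d))) (H : SimpleGraph V) (m : ℕ),
            IsSteinerSpanner (1 + ε) (onXAxis d (X : Set ℝ)) H →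
            H.edgeSet.encard ≤ (m : ℕ∞) →
            ENNReal.ofReal (c * (invAck m n : ℝ)) ≤
              ((spannerDiameter (1 + ε) (onXAxis d (X : Set ℝ)) H : ℕ∞) : ℝ≥0∞) := by
  refine ⟨1 / 5, by norm_num, fun ε hε n hn => ?_⟩
  obtain ⟨R, hR⟩ := exists_nat_ge (2 * (1 + ε) + 2)
  have hR2 : 2 ≤ R := by
    have : (2 : ℝ) ≤ R := by linarith
    exact_mod_cast this
  refine ⟨(Finset.range n).image fun i => (spread R i : ℝ), ?_, ?_⟩
  · rw [Finset.card_image_of_injective, Finset.card_range]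
    exact Nat.cast_injective.comp (spread_injective hR2)
  intro d _ V H m hH hm
  set X := onXAxis d (((Finset.range n).image fun i => (spread R i : ℝ) : Finset ℝ) : Set ℝ) with hX
  have hmem : ∀ i < n, EuclideanSpace.single (0 : Fin d) (spread R i : ℝ) ∈ X := fun i hi =>
    Set.mem_image_of_mem _ (Finset.mem_coe.2 (Finset.mem_image_of_mem _ (Finset.mem_range.2 hi)))
  rcases eq_or_ne (spannerDiameter (1 + ε) X H) ⊤ with htop | htop
  · simp [htop]
  obtain ⟨k, hk⟩ := ENat.ne_top_iff_exists.1 htop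
  rw [← hk]
  have hn0 : 0 < n := by omega
  set x : ℕ → V := fun i =>
    if hi : i < n then ⟨_, hH.subset (hmem i hi)⟩ else ⟨_, hH.subset (hmem 0 hn0)⟩ with hxdef
  have hxi : ∀ i < n, (x i : EuclideanSpace ℝ (Fin d))
      = EuclideanSpace.single 0 (spread R i : ℝ) := by
    intro i hi
    simp [hxdef, hi]
  have hdist : ∀ i < n, ∀ j < n, dist (x i : EuclideanSpace ℝ (Fin d)) (x j)
      = |(spread R i : ℝ) - spread R j| := by
    intro i hi j hj
    rw [hxi i hi, hxi j hj, PiLp.dist_single_same, Real.dist_eq]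
  have hxne : ∀ i < n, ∀ j < n, i ≠ j → x i ≠ x j := by
    intro i hi j hj hij heq
    have h0 := hdist i hi j hj
    rw [heq, dist_self] at h0
    have h1 : spread R i = spread R j := by
      exact_mod_cast sub_eq_zero.1 (abs_eq_zero.1 h0.symm)
    exact hij (spread_injective hR2 h1)
  have hwalk : ∀ i < n, ∀ j < n, i ≠ j →
      ∃ w : H.Walk (x i) (x j), IsSpannerPath (1 + ε) w ∧ w.length ≤ k := fun i hi j hj hij =>
    exists_walk_length_le_of_spannerDiameter_le hk.ge (by rw [hxi i hi]; exact hmem i hi)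
      (by rw [hxi j hj]; exact hmem j hj) (hxne i hi j hj hij)
  -- Two distinct points give `1 ≤ k` and `1 ≤ m`; then `k + 4 ≤ 5k` explains the constant `1 / 5`.
  obtain ⟨w, -, hwk⟩ := hwalk 0 hn0 1 (by omega) (by omega)
  have hnil : ¬ w.Nil := SimpleGraph.Walk.not_nil_of_ne (hxne 0 hn0 1 (by omega) (by omega))
  have hwpos : 0 < w.length := SimpleGraph.Walk.not_nil_iff_lt_length.1 hnil
  have hm1 : 1 ≤ m := by
    have hedge : s(w.getVert 0, w.getVert 1) ∈ H.edgeSet := w.adj_getVert_succ hwpos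
    have := (Set.one_le_encard_iff_nonempty.2 ⟨_, hedge⟩).trans hm
    exact_mod_cast this
  have hα := invAck_le_add_four hn hm1 (k := k) (t := 1 + ε) (by linarith) hR x hdist
    (fun i hi j hj => by
      rcases eq_or_ne i j with rfl | hij
      · exact ⟨.nil, by simp [walkWeight], by simp⟩
      · obtain ⟨w, hw, hlen⟩ := hwalk i hi j hj hij
        exact ⟨w, hw.2, hlen⟩) hm
  have hfin : 1 / 5 * (invAck m n : ℝ) ≤ k := by
    have : invAck m n ≤ 5 * k := by omega
    have : (invAck m n : ℝ) ≤ 5 * k := by exact_mod_cast this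
    linarith
  calc ENNReal.ofReal (1 / 5 * (invAck m n : ℝ)) ≤ ENNReal.ofReal k := ENNReal.ofReal_le_ofReal hfin
    _ = (((k : ℕ∞) : ℕ∞) : ℝ≥0∞) := by simp
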